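/- For a finite simple graph $G$ and $S\subseteq V(G)$, let $B(S)$ be the set of vertices outside $S$ that have a neighbour in $S$, and let $B(G;x,y)=\sum_{S\subseteq V(G)}x^{|B(S)|}y^{|S|}$ be the boundary polynomial of $G$. For finite simple graphs $G_1,G_2$ consider the planar system $$\frac{dx}{dt}=\alpha x-y+B(G_1;x,y)-1,\qquad \frac{dy}{dt}=x+\alpha y+B(G_2;x,y)-1,$$ and let $\sigma_B=\sigma_B(G_1,G_2)$ be the Liapunov number of the origin for $\alpha=0$, that is, $\sigma_B=d'''(0)$, where $d(s)=P(s)-s$ and $P$ is the Poincaré map at the origin: $P(0)=0$ and, for small $s\neq0$, the trajectory starting at $(s,0)$ first returns to the open half-axis from the origin through $(s,0)$ at the point $(P(s),0)$. Let $K_n$, $C_n$, $P_n$ be the complete graph, the cycle and the path of order $n$, let $S_n$ be the star of order $n$ (one vertex joined to $n-1$ vertices of degree $1$), and let $W_n$ be the wheel of order $n$ (a cycle of order $n-1$ and one more vertex joined to all vertices of the cycle). Let $G_2=P_2$ (up to isomorphism). (a) If $G_1$ is (isomorphic to) $K_3=C_3$, or $S_n$ with $n\ge2$, then $P$ is well defined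 and three times continuously differentiable in a neighbourhood of $0$, and $\sigma_B>0$. (b) If $G_1$ is (isomorphic to) $K_n$, $C_n$ or $W_n$ with $n\ge4$, then $P$ is well defined and three times continuously differentiable in a neighbourhood of $0$, and $\sigma_B<0$. -/

import Mathlib

open Set Filter Topology

/-! ## Graphs and the boundary polynomial -/

/-- The boundary `B(S)`: the vertices outside `S` that have a neighbour in `S`. -/
def vertexBoundary {V : Type*} (G : SimpleGraph V) (S : Finset V) : Set V :=
  {v | v ∉ S ∧ ∃ u ∈ S, G.Adj u v}

/-- The boundary polynomial `B(G; x, y) = ∑_{S ⊆ V(G)} x ^ |B(S)| * y ^ |S|`, as a function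
of the real variables `x` and `y`. -/
noncomputable def boundaryPoly {V : Type*} [Fintype V] (G : SimpleGraph V) (x y : ℝ) : ℝ :=
  ∑ S : Finset V, x ^ (vertexBoundary G S).ncard * y ^ S.card

/-- The star `S_n` of order `n`: the vertex `0` is joined to all the other vertices. -/
def starGraph (n : ℕ) : SimpleGraph (Fin n) where
  Adj i j := i ≠ j ∧ (i.val = 0 ∨ j.val = 0)
  symm := ⟨fun _ _ h => ⟨h.1.symm, h.2.symm⟩⟩
  loopless := ⟨fun _ h => h.1 rfl⟩

/-- The adjacency relation of the wheel of order `n`: `none` is the hub, and the vertices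
`some i` form a cycle of order `n - 1`. -/
def wheelAdj (n : ℕ) : Option (Fin (n - 1)) → Option (Fin (n - 1)) → Prop
  | none, none => False
  | none, some _ => True
  | some _, none => True
  | some i, some j => (SimpleGraph.cycleGraph (n - 1)).Adj i j

/-- The wheel `W_n` of order `n`: a cycle of order `n - 1` and a hub joined to all its
vertices. -/
def wheelGraph (n : ℕ) : SimpleGraph (Option (Fin (n - 1))) where
  Adj := wheelAdj n
  symm := ⟨by
    rintro (_ | i) (_ | j) h
    · exact h
    · trivial
    · trivial
    · exact SimpleGraph.Adj.symm h⟩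
  loopless := ⟨by
    rintro (_ | i) h
    · exact h
    · exact SimpleGraph.irrefl _ h⟩

/-! ## Poincaré map and Liapunov number of a planar vector field at the origin -/

/-- `(t, 0)` is the first return of the trajectory of `f` through `(s, 0)` to the open
half-axis `{(x, 0) | 0 < s * x}` from the origin that contains `(s, 0)`: the trajectory
starting at `(s, 0)` is at `(t, 0)` at some time `T > 0`, the point `(t, 0)` is on this
half-axis, and the trajectory does not meet this half-axis at times strictly between
`0` and `T`. -/
def IsFirstReturn (f : ℝ × ℝ → ℝ × ℝ) (s t : ℝ) : Prop :=
  0 < s * t ∧ ∃ T : ℝ, 0 < T ∧ ∃ γ : ℝ → ℝ × ℝ,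
    IsIntegralCurveOn γ (fun _ => f) (Icc 0 T) ∧ γ 0 = (s, 0) ∧ γ T = (t, 0) ∧
    ∀ τ ∈ Ioo 0 T, ¬ ((γ τ).2 = 0 ∧ 0 < s * (γ τ).1)

open Classical in
/-- The Poincaré (first return) map at the origin along the horizontal axis. For a vector
field with a focus at the origin it is defined for small `s` of either sign (`s < 0`
corresponds to the negative half-axis), and its value at `0` is `0`. Outside the domain of
the return map the value is `0` by convention. -/
noncomputable def poincareMap (f : ℝ × ℝ → ℝ × ℝ) (s : ℝ) : ℝ :=
  if h : ∃ t, IsFirstReturn f s t then h.choose else 0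

/-- The Poincaré map at the origin exists near the origin and is three times continuously
differentiable there, so that the third derivative of the displacement function at the
origin makes sense. -/
def LiapunovNumberExists (f : ℝ × ℝ → ℝ × ℝ) : Prop :=
  (∀ᶠ s in 𝓝[≠] (0 : ℝ), ∃! t, IsFirstReturn f s t) ∧ ContDiffAt ℝ 3 (poincareMap f) 0

/-- The Liapunov number of a weak focus at the origin: the third derivative at `0` of the
displacement function `d(s) = P(s) - s`, where `P` is the Poincaré map. -/
noncomputable def liapunovNumber (f : ℝ × ℝ → ℝ × ℝ) : ℝ :=
  iteratedDeriv 3 (fun s => poincareMap f s - s) 0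

/-! ## The planar system of a pair of graphs -/

/-- The vector field of the system
`x' = α x - y + B(G₁; x, y) - 1`, `y' = x + α y + B(G₂; x, y) - 1`. -/
noncomputable def boundaryField {V₁ V₂ : Type*} [Fintype V₁] [Fintype V₂] (α : ℝ)
    (G₁ : SimpleGraph V₁) (G₂ : SimpleGraph V₂) (p : ℝ × ℝ) : ℝ × ℝ :=
  (α * p.1 - p.2 + boundaryPoly G₁ p.1 p.2 - 1, p.1 + α * p.2 + boundaryPoly G₂ p.1 p.2 - 1)

/-- `σ_B`, the Liapunov number at the origin of the system of `G₁`, `G₂` with `α = 0`. -/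
noncomputable def sigmaB {V₁ V₂ : Type*} [Fintype V₁] [Fintype V₂]
    (G₁ : SimpleGraph V₁) (G₂ : SimpleGraph V₂) : ℝ :=
  liapunovNumber (boundaryField 0 G₁ G₂)

/-! In polar coordinates a field `x' = -y + ⋯`, `y' = x + ⋯` whose remaining terms have degree at
least 2 reads `r' = r² A(r)`, `θ' = 1 + r B(r)`, where the coefficients `A_k`, `B_k` are functions
of `θ`. With `r = sη`, `η(0) = 1`, the trajectory over one turn satisfies `η = 1 + s V(η² A(sη) / (1
+ sη B(sη)))`, where `V` is the primitive from `0`. This is an equation in the Banach algebra `C([0,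
2π])`, and the implicit function theorem at `(s, η) = (0, 1)` solves it smoothly in `s`
(`exists_fixedPoint_branch`). The solution gives `P(s) = s η_s(2π)` for both signs of `s`
(`isFirstReturn_of_fixedPoint`), hence the regularity of `P`.

So `P(s) - s = s² L(K(s))`, where `K(s)` is the integrand and `L` is integration over the turn, and
`K'(0) = 2 V(A_0) A_0 + A_1 - A_0 B_0`. The first summand integrates to `(∫ A_0)² = 0`, which leaves
`σ = 6 ∫ (A_1 - A_0 B_0)` (`liapunovNumber_componentField`).

Without isolated vertices, `B(G; x, y) - 1` has no terms of degree below 2. If `b_ij` counts the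
`j`-sets with boundary of size `i` in `G₁`, and `B(P_2) = 1 + 2xy + y²`, the integral gives `σ =
(3π/2)(b_11 b_02 + 2 b_02 + b_12 - 2)` (`sigmaB_complete_two`). Only small neighbourhoods remain to
be counted: in (b) every pair has a closed neighbourhood of size at least 4, so `b_02 = b_12 = 0`;
in (a) either `b_12 ≥ 3`, or `G₁ = K_2` with `b_11 = 2`, `b_02 = 1`. -/

/-! ## A fixed point equation in a Banach algebra -/

section Branch

variable {E : Type*} [NormedCommRing E]

/-- The polynomial `∑_{k < n} A_k r ^ k` with coefficients in a commutative algebra. -/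
def coeffSum (A : ℕ → E) (n : ℕ) (r : E) : E := ∑ k ∈ Finset.range n, A k * r ^ k

/-- The right-hand side `A(r) / (1 + r B(r))`. -/
noncomputable def radialRatio (A B : ℕ → E) (n : ℕ) (r : E) : E :=
  coeffSum A n r * Ring.inverse (1 + r * coeffSum B n r)

theorem coeffSum_zero (A : ℕ → E) (n : ℕ) : coeffSum A (n + 1) 0 = A 0 := by
  simp [coeffSum, Finset.sum_range_succ']

variable [NormedAlgebra ℝ E]

theorem contDiff_coeffSum (A : ℕ → E) (n : ℕ) : ContDiff ℝ 4 (coeffSum A n) := by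
  unfold coeffSum
  fun_prop

/-- Since `ρ` vanishes at `0`, only the linear term contributes; `n + 2` terms guarantee that it is
present. -/
theorem hasDerivAt_coeffSum_comp (A : ℕ → E) (n : ℕ) {ρ : ℝ → E} {v : E} (h0 : ρ 0 = 0)
    (hρ : HasDerivAt ρ v 0) :
    HasDerivAt (fun s => coeffSum A (n + 2) (ρ s)) (A 1 * v) 0 := by
  unfold coeffSum
  refine (HasDerivAt.fun_sum (fun k _ => (hρ.pow k).const_mul (A k))).congr_deriv ?_
  rw [Finset.sum_eq_single 1]
  · simp
  · intro k _ hk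
    rcases k with _ | _ | k
    · simp
    · simp at hk
    · simp [h0]
  · simp

variable [CompleteSpace E]

theorem contDiffAt_radialRatio (A B : ℕ → E) (n : ℕ) :
    ContDiffAt ℝ 4 (radialRatio A B n) 0 := by
  unfold radialRatio
  refine (contDiff_coeffSum A n).contDiffAt.mul ?_
  have h1 : ContDiffAt ℝ 4 (Ring.inverse : E → E) (1 + 0 * coeffSum B n 0) := by
    simpa using contDiffAt_ringInverse ℝ (1 : Eˣ)
  have h2 : ContDiffAt ℝ 4 (fun r : E => 1 + r * coeffSum B n r) 0 :=
    contDiffAt_const.add (contDiffAt_id.mul (contDiff_coeffSum B n).contDiffAt)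
  exact ContDiffAt.comp (0 : E) h1 h2

theorem hasDerivAt_radialRatio_comp (A B : ℕ → E) (n : ℕ) {ρ : ℝ → E} {v : E} (h0 : ρ 0 = 0)
    (hρ : HasDerivAt ρ v 0) :
    HasDerivAt (fun s => radialRatio A B (n + 2) (ρ s)) (A 1 * v - A 0 * (v * B 0)) 0 := by
  unfold radialRatio
  have hinv : HasFDerivAt (Ring.inverse : E → E)
      (-ContinuousLinearMap.mulLeftRight ℝ E 1 1) (1 + ρ 0 * coeffSum B (n + 2) (ρ 0)) := by
    simpa [h0] using hasFDerivAt_ringInverse (𝕜 := ℝ) (1 : Eˣ)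
  have hw : HasDerivAt (fun s => 1 + ρ s * coeffSum B (n + 2) (ρ s)) (v * B 0) 0 := by
    refine ((hρ.mul (hasDerivAt_coeffSum_comp B n h0 hρ)).const_add 1).congr_deriv ?_
    simp [h0, coeffSum_zero]
  refine ((hasDerivAt_coeffSum_comp A n h0 hρ).mul
    (hinv.comp_hasDerivAt (0 : ℝ) hw)).congr_deriv ?_
  simp [h0, coeffSum_zero, sub_eq_add_neg]

/-- The equation `η = 1 + s V(η² A(sη) / (1 + sη B(sη)))` has a smooth branch of solutions
through `(s, η) = (0, 1)`. -/
theorem exists_fixedPoint_branch (A B : ℕ → E) (n : ℕ) (V : E →L[ℝ] E) :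
    ∃ η : ℝ → E, ContDiffAt ℝ 4 η 0 ∧ η 0 = 1 ∧
      ∀ᶠ s in 𝓝 (0 : ℝ), η s = 1 + s • V (η s ^ 2 * radialRatio A B n (s • η s)) := by
  set K : ℝ × E → E := fun u => u.2 ^ 2 * radialRatio A B n (u.1 • u.2) with hK
  set Φ : ℝ × E → E := fun u => u.2 - u.1 • V (K u) with hΦ
  have hKc : ContDiffAt ℝ 4 K (0, 1) := by
    have h1 : ContDiffAt ℝ 4 (radialRatio A B n) ((0 : ℝ) • (1 : E)) := by
      simpa using contDiffAt_radialRatio A B n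
    have h2 : ContDiffAt ℝ 4 (fun u : ℝ × E => u.1 • u.2) (0, 1) := by fun_prop
    exact (contDiffAt_snd.pow 2).mul (h1.fun_comp ((0 : ℝ), (1 : E)) h2)
  have hΦc : ContDiffAt ℝ 4 Φ (0, 1) :=
    contDiffAt_snd.sub (contDiffAt_fst.smul (V.contDiff.contDiffAt.comp _ hKc))
  -- The nonlinear term carries the factor `s`, so at `s = 0` the partial map in `η` is the
  -- identity.
  have hinr : fderiv ℝ Φ (0, 1) ∘L .inr ℝ ℝ E = ContinuousLinearMap.id ℝ E := by
    have h1 : HasFDerivAt (fun e : E => Φ (0, e)) (fderiv ℝ Φ (0, 1) ∘L .inr ℝ ℝ E) 1 :=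
      HasFDerivAt.comp (1 : E) (hΦc.differentiableAt (by norm_num)).hasFDerivAt
        (hasFDerivAt_prodMk_right (0 : ℝ) (1 : E))
    have h2 : HasFDerivAt (fun e : E => Φ (0, e)) (ContinuousLinearMap.id ℝ E) 1 := by
      simpa [hΦ] using! hasFDerivAt_id (𝕜 := ℝ) (1 : E)
    exact h1.unique h2
  have hinv : (fderiv ℝ Φ (0, 1) ∘L .inr ℝ ℝ E).IsInvertible := by
    rw [hinr]
    exact ⟨ContinuousLinearEquiv.refl ℝ E, rfl⟩
  have h4 : (4 : WithTop ℕ∞) ≠ 0 := by norm_num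
  refine ⟨hΦc.implicitFunction h4 hinv, hΦc.contDiffAt_implicitFunction h4 hinv,
    hΦc.implicitFunction_apply_self h4 hinv, ?_⟩
  filter_upwards [hΦc.eventually_apply_implicitFunction h4 hinv] with s hs
  have hs' : hΦc.implicitFunction h4 hinv s
      - s • V (K (s, hΦc.implicitFunction h4 hinv s)) = 1 := by
    simpa [hΦ] using hs
  exact sub_eq_iff_eq_add.1 hs'

/-- Along a branch `η` as in `exists_fixedPoint_branch`, the integrand is smooth, and its
derivative at the origin is as computed from the power series. -/
theorem branch_integrand (A B : ℕ → E) (n : ℕ) (V : E →L[ℝ] E) {η : ℝ → E}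
    (hη : ContDiffAt ℝ 4 η 0) (h1 : η 0 = 1)
    (heq : ∀ᶠ s in 𝓝 (0 : ℝ),
      η s = 1 + s • V (η s ^ 2 * radialRatio A B (n + 2) (s • η s))) :
    ContDiffAt ℝ 4 (fun s => η s ^ 2 * radialRatio A B (n + 2) (s • η s)) 0 ∧
    η 0 ^ 2 * radialRatio A B (n + 2) ((0 : ℝ) • η 0) = A 0 ∧
    HasDerivAt (fun s => η s ^ 2 * radialRatio A B (n + 2) (s • η s))
      (2 * (V (A 0) * A 0) + (A 1 - A 0 * B 0)) 0 := by
  have hK0 : η 0 ^ 2 * radialRatio A B (n + 2) ((0 : ℝ) • η 0) = A 0 := by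
    simp [h1, radialRatio, coeffSum_zero]
  have hKc : ContDiffAt ℝ 4 (fun s => η s ^ 2 * radialRatio A B (n + 2) (s • η s)) 0 := by
    have h : ContDiffAt ℝ 4 (radialRatio A B (n + 2)) ((0 : ℝ) • η 0) := by
      simpa using contDiffAt_radialRatio A B (n + 2)
    exact (hη.pow 2).mul (h.fun_comp (0 : ℝ) (contDiffAt_fun_id.fun_smul hη))
  refine ⟨hKc, hK0, ?_⟩
  -- Differentiate the fixed point equation: the factor `s` leaves only the value of the integrand
  -- at `0`, which is `A 0`.
  have hd : HasDerivAt η (V (A 0)) 0 := by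
    have hVK := (V.hasFDerivAt.comp_hasDerivAt (0 : ℝ)
      (hKc.differentiableAt (by norm_num)).hasDerivAt)
    have h := ((hasDerivAt_id (0 : ℝ)).smul hVK).const_add 1
    refine (h.congr_of_eventuallyEq (heq.mono fun s hs => hs)).congr_deriv ?_
    simp [h1, radialRatio, coeffSum_zero]
  have hρ : HasDerivAt (fun s : ℝ => s • η s) 1 0 := by
    simpa [h1] using! (hasDerivAt_id (0 : ℝ)).smul hd
  refine ((hd.pow 2).mul (hasDerivAt_radialRatio_comp A B n (by simp) hρ)).congr_deriv ?_
  simp [h1, radialRatio, coeffSum_zero]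
  ring

end Branch

/-! ## First returns of planar trajectories -/

/-- The field is only locally Lipschitz, but the two traces form a compact set, on which one
Lipschitz constant serves for the uniqueness theorem. -/
theorem IsIntegralCurveOn.eqOn_Icc {E : Type*} [NormedAddCommGroup E] [NormedSpace ℝ E]
    {f : E → E} (hf : ContDiff ℝ 1 f) {γ₁ γ₂ : ℝ → E} {a b : ℝ}
    (h₁ : IsIntegralCurveOn γ₁ (fun _ => f) (Icc a b))
    (h₂ : IsIntegralCurveOn γ₂ (fun _ => f) (Icc a b)) (h : γ₁ a = γ₂ a) :
    EqOn γ₁ γ₂ (Icc a b) := by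
  obtain ⟨K, hK⟩ := (hf.locallyLipschitz.locallyLipschitzOn
    (s := γ₁ '' Icc a b ∪ γ₂ '' Icc a b)).exists_lipschitzOnWith_of_compact
      ((isCompact_Icc.image_of_continuousOn h₁.continuousOn).union
        (isCompact_Icc.image_of_continuousOn h₂.continuousOn))
  have hright : ∀ {γ : ℝ → E}, IsIntegralCurveOn γ (fun _ => f) (Icc a b) →
      ∀ t ∈ Ico a b, HasDerivWithinAt γ (f (γ t)) (Ici t) t := fun hγ t ht =>
    ((hγ t (Ico_subset_Icc_self ht)).mono (Icc_subset_Icc_left ht.1)).mono_of_mem_nhdsWithin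
      (Icc_mem_nhdsGE ht.2)
  exact ODE_solution_unique_of_mem_Icc_right (fun _ _ => hK) h₁.continuousOn (hright h₁)
    (fun t ht => Or.inl ⟨t, Ico_subset_Icc_self ht, rfl⟩) h₂.continuousOn (hright h₂)
    (fun t ht => Or.inr ⟨t, Ico_subset_Icc_self ht, rfl⟩) h

/-- Both curves agree up to the smaller return time, so unequal times would put a crossing of the
half-axis strictly before the later return. -/
theorem IsFirstReturn.unique {f : ℝ × ℝ → ℝ × ℝ} (hf : ContDiff ℝ 1 f) {s t₁ t₂ : ℝ}
    (h₁ : IsFirstReturn f s t₁) (h₂ : IsFirstReturn f s t₂) : t₁ = t₂ := by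
  obtain ⟨hs₁, T₁, hT₁, γ₁, hγ₁, h0₁, hend₁, hno₁⟩ := h₁
  obtain ⟨hs₂, T₂, hT₂, γ₂, hγ₂, h0₂, hend₂, hno₂⟩ := h₂
  rcases lt_trichotomy T₁ T₂ with hlt | rfl | hlt
  · have he := hγ₁.eqOn_Icc hf (hγ₂.mono (Icc_subset_Icc_right hlt.le)) (h0₁.trans h0₂.symm)
    refine absurd ?_ (hno₂ T₁ ⟨hT₁, hlt⟩)
    rw [← he ⟨hT₁.le, le_rfl⟩, hend₁]
    exact ⟨rfl, hs₁⟩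
  · have he := hγ₁.eqOn_Icc hf hγ₂ (h0₁.trans h0₂.symm) ⟨hT₁.le, le_rfl⟩
    rw [hend₁, hend₂] at he
    exact congrArg Prod.fst he
  · have he := (hγ₁.mono (Icc_subset_Icc_right hlt.le)).eqOn_Icc hf hγ₂ (h0₁.trans h0₂.symm)
    refine absurd ?_ (hno₁ T₂ ⟨hT₂, hlt⟩)
    rw [he ⟨hT₂.le, le_rfl⟩, hend₂]
    exact ⟨rfl, hs₂⟩

/-- The angle as a function of time, when the angular velocity `D` is a given function of the
angle. -/
theorem exists_angle_of_angularVelocity {D : ℝ → ℝ} (hD : Continuous D)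
    (hlo : ∀ θ, 1 / 2 ≤ D θ) (hhi : ∀ θ, D θ ≤ 2) :
    ∃ φ : ℝ → ℝ, StrictMono φ ∧ Function.Surjective φ ∧ φ 0 = 0 ∧
      ∀ t, HasDerivAt φ (D (φ t)) t := by
  have hpos : ∀ θ, 0 < D θ := fun θ => lt_of_lt_of_le (by norm_num) (hlo θ)
  have hcont : Continuous fun θ => (D θ)⁻¹ := hD.inv₀ fun θ => (hpos θ).ne'
  -- Time as a function of the angle; the required angle function is its inverse. As `D ≤ 2`, its
  -- slope is at least `1/2`, which gives strict monotonicity and surjectivity.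
  set τ : ℝ → ℝ := fun θ => ∫ u in (0 : ℝ)..θ, (D u)⁻¹ with hτ
  have hder : ∀ θ, HasDerivAt τ (D θ)⁻¹ θ := fun θ =>
    intervalIntegral.integral_hasDerivAt_right (hcont.intervalIntegrable _ _)
      (hcont.stronglyMeasurableAtFilter _ _) hcont.continuousAt
  have hτ0 : τ 0 = 0 := intervalIntegral.integral_same
  have hder' : ∀ θ, HasDerivAt (fun u => τ u - u / 2) ((D θ)⁻¹ - 1 / 2) θ := fun θ =>
    (hder θ).sub ((hasDerivAt_id θ).div_const 2)
  have hmono : Monotone fun u => τ u - u / 2 := by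
    refine monotone_of_deriv_nonneg (fun θ => (hder' θ).differentiableAt) fun θ => ?_
    rw [(hder' θ).deriv, sub_nonneg, one_div]
    exact inv_anti₀ (hpos θ) (hhi θ)
  have hstrict : StrictMono τ := fun a b hab => by
    have := hmono hab.le
    simp only at this
    linarith
  have hsurj : Function.Surjective τ := by
    refine (continuous_iff_continuousAt.2 fun θ => (hder θ).continuousAt).surjective ?_ ?_
    · refine tendsto_atTop_mono' atTop ?_ (tendsto_id.atTop_div_const (two_pos : (0 : ℝ) < 2))
      filter_upwards [eventually_ge_atTop (0 : ℝ)] with θ hθ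
      have := hmono hθ
      simp only [hτ0] at this
      simp only [id]
      linarith
    · refine tendsto_atBot_mono' atBot ?_ (tendsto_id.atBot_div_const (two_pos : (0 : ℝ) < 2))
      filter_upwards [eventually_le_atBot (0 : ℝ)] with θ hθ
      have := hmono hθ
      simp only [hτ0] at this
      simp only [id]
      linarith
  set e := hstrict.orderIsoOfSurjective τ hsurj with he
  have hτe : ∀ t, τ (e.symm t) = t := fun t => e.apply_symm_apply t
  refine ⟨e.symm, e.symm.strictMono, e.symm.surjective, ?_, fun t => ?_⟩
  · rw [OrderIso.symm_apply_eq]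
    exact hτ0.symm
  · simpa using HasDerivAt.of_local_left_inverse e.symm.continuous.continuousAt
      (hder (e.symm t)) (inv_ne_zero (hpos _).ne') (Eventually.of_forall hτe)

/-- A solution `R` of the equation of the trajectories in polar coordinates over a full turn
gives a first return. `D` is the angular velocity along the trajectory. -/
theorem isFirstReturn_of_polar {f : ℝ × ℝ → ℝ × ℝ} {s : ℝ} {R R' D : ℝ → ℝ} (hR0 : R 0 = s)
    (hD : Continuous D) (hlo : ∀ θ, 1 / 2 ≤ D θ) (hhi : ∀ θ, D θ ≤ 2)
    (hR : ∀ θ, HasDerivAt R (R' θ) θ)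
    (hpos : ∀ θ ∈ Icc 0 (2 * Real.pi), 0 < s * R θ)
    (hf : ∀ θ ∈ Icc 0 (2 * Real.pi), f (R θ * Real.cos θ, R θ * Real.sin θ) =
      ((R' θ * Real.cos θ - R θ * Real.sin θ) * D θ,
        (R' θ * Real.sin θ + R θ * Real.cos θ) * D θ)) :
    IsFirstReturn f s (R (2 * Real.pi)) := by
  have hpi := Real.two_pi_pos
  obtain ⟨φ, hφm, hφs, hφ0, hφ⟩ := exists_angle_of_angularVelocity hD hlo hhi
  obtain ⟨T, hT⟩ := hφs (2 * Real.pi)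
  have hT0 : 0 < T := hφm.lt_iff_lt.1 (by rw [hφ0, hT]; exact hpi)
  have hmem : ∀ t ∈ Icc 0 T, φ t ∈ Icc 0 (2 * Real.pi) := fun t ht =>
    ⟨hφ0 ▸ hφm.monotone ht.1, hT ▸ hφm.monotone ht.2⟩
  refine ⟨hpos _ ⟨hpi.le, le_rfl⟩, T, hT0,
    fun t => (R (φ t) * Real.cos (φ t), R (φ t) * Real.sin (φ t)), ?_, ?_, ?_, ?_⟩
  · intro t ht
    beta_reduce
    rw [hf _ (hmem t ht)]
    have hRφ := (hR (φ t)).comp t (hφ t)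
    have h1 := hRφ.mul (hφ t).cos
    have h2 := hRφ.mul (hφ t).sin
    refine (HasDerivAt.prodMk (h1.congr_deriv ?_) (h2.congr_deriv ?_)).hasDerivWithinAt
    · simp only [Function.comp]; ring
    · simp only [Function.comp]; ring
  · simp [hφ0, hR0]
  · simp [hT]
  · rintro t ht ⟨hsin, hx⟩
    have h1 : 0 < φ t := hφ0 ▸ hφm ht.1
    have h2 : φ t < 2 * Real.pi := hT ▸ hφm ht.2
    have hp := hpos _ (hmem t (Ioo_subset_Icc_self ht))
    have hRne : R (φ t) ≠ 0 := right_ne_zero_of_mul hp.ne'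
    have hs0 : Real.sin (φ t) = 0 := by simpa [hRne] using hsin
    have hcos : 0 < Real.cos (φ t) := by
      refine pos_of_mul_pos_right (a := s * R (φ t)) ?_ hp.le
      simpa [mul_assoc] using hx
    -- A crossing of the same half-axis has zero sine and positive cosine, so the cosine is `1`,
    -- impossible strictly inside the turn.
    have hne := (Real.cos_eq_one_iff_of_lt_of_lt (by linarith) h2).not.2 h1.ne'
    have hsq := Real.sin_sq_add_cos_sq (φ t)
    rw [hs0] at hsq
    apply hne
    nlinarith

/-! ## The equation of the trajectories in polar coordinates -/

/-- The continuous functions of the polar angle over one full turn. -/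
abbrev TurnSpace := C(Icc (0 : ℝ) (2 * Real.pi), ℝ)

/-- The extension of a function of the angle to the line by constants. -/
noncomputable def turnExtend (g : TurnSpace) : C(ℝ, ℝ) :=
  ContinuousMap.IccExtend Real.two_pi_pos.le g

theorem turnExtend_of_mem (g : TurnSpace) {θ : ℝ} (hθ : θ ∈ Icc 0 (2 * Real.pi)) :
    turnExtend g θ = g ⟨θ, hθ⟩ :=
  IccExtend_of_mem _ _ hθ

theorem norm_turnExtend_le (g : TurnSpace) (θ : ℝ) : ‖turnExtend g θ‖ ≤ ‖g‖ :=
  g.norm_coe_le_norm _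

theorem hasDerivAt_integral_turnExtend (g : TurnSpace) (θ : ℝ) :
    HasDerivAt (fun θ => ∫ u in (0 : ℝ)..θ, turnExtend g u) (turnExtend g θ) θ :=
  intervalIntegral.integral_hasDerivAt_right
    ((turnExtend g).continuous.intervalIntegrable _ _)
    ((turnExtend g).continuous.stronglyMeasurableAtFilter _ _)
    (turnExtend g).continuous.continuousAt

/-- The operator `g ↦ (θ ↦ ∫_0^θ g)`. -/
noncomputable def turnPrimitive : TurnSpace →L[ℝ] TurnSpace :=
  LinearMap.mkContinuous
    { toFun := fun g => ⟨fun θ => ∫ u in (0 : ℝ)..θ, turnExtend g u,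
        (continuous_iff_continuousAt.2 fun θ =>
          (hasDerivAt_integral_turnExtend g θ).continuousAt).comp continuous_subtype_val⟩
      map_add' := fun g h => by
        ext θ
        exact intervalIntegral.integral_add
          ((turnExtend g).continuous.intervalIntegrable _ _)
          ((turnExtend h).continuous.intervalIntegrable _ _)
      map_smul' := fun c g => by
        ext θ
        exact intervalIntegral.integral_smul c _ }
    (2 * Real.pi) fun g => by
      refine (ContinuousMap.norm_le _ (by positivity)).2 fun θ => ?_
      refine (intervalIntegral.norm_integral_le_of_norm_le_const
        fun u _ => norm_turnExtend_le g u).trans ?_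
      rw [sub_zero, abs_of_nonneg θ.2.1, mul_comm]
      exact mul_le_mul_of_nonneg_right θ.2.2 (norm_nonneg g)

theorem turnPrimitive_apply (g : TurnSpace) (θ : Icc (0 : ℝ) (2 * Real.pi)) :
    turnPrimitive g θ = ∫ u in (0 : ℝ)..θ, turnExtend g u := rfl

/-- The endpoint of a full turn. -/
noncomputable def turnEnd : Icc (0 : ℝ) (2 * Real.pi) := ⟨2 * Real.pi, Real.two_pi_pos.le, le_rfl⟩

theorem turnPrimitive_turnEnd_eq_sub {g : TurnSpace} {F f : ℝ → ℝ}
    (hF : ∀ θ, HasDerivAt F (f θ) θ) (hf : Continuous f)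
    (hg : ∀ θ : Icc (0 : ℝ) (2 * Real.pi), g θ = f θ) :
    turnPrimitive g turnEnd = F (2 * Real.pi) - F 0 := by
  rw [← intervalIntegral.integral_eq_sub_of_hasDerivAt (fun θ _ => hF θ)
    (hf.intervalIntegrable _ _)]
  refine intervalIntegral.integral_congr fun θ hθ => ?_
  replace hθ : θ ∈ Icc 0 (2 * Real.pi) := by rwa [← uIcc_of_le Real.two_pi_pos.le]
  simp only [turnExtend_of_mem _ hθ, hg]

/-- If `G` is the primitive of `g`, then `2 G g` is the derivative of `G²`. This removes the
contribution of `2 V(A_0) A_0` when `A_0` has mean zero. -/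
theorem turnPrimitive_primitive_mul_self (g : TurnSpace) :
    turnPrimitive (2 * (turnPrimitive g * g)) turnEnd = turnPrimitive g turnEnd ^ 2 := by
  have hc : Continuous fun θ => ∫ u in (0 : ℝ)..θ, turnExtend g u :=
    continuous_iff_continuousAt.2 fun θ => (hasDerivAt_integral_turnExtend g θ).continuousAt
  rw [turnPrimitive_turnEnd_eq_sub (F := fun θ => (∫ u in (0 : ℝ)..θ, turnExtend g u) ^ 2)
    (f := fun θ => 2 * ((∫ u in (0 : ℝ)..θ, turnExtend g u) * turnExtend g θ))
    (fun θ => ((hasDerivAt_integral_turnExtend g θ).fun_pow 2).congr_deriv (by simp; ring))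
    (by fun_prop) (fun θ => by
      rw [turnExtend_of_mem _ θ.2]
      rfl)]
  simp only [intervalIntegral.integral_same, zero_pow two_ne_zero, sub_zero]
  rfl

/-! ### Fields that are sums of homogeneous components -/

section Components

/-- The planar field `x' = -y + ∑ p_k, y' = x + ∑ q_k` with given components `p_k, q_k`, `k < n`. -/
noncomputable def componentField (p q : ℕ → C(ℝ × ℝ, ℝ)) (n : ℕ) (v : ℝ × ℝ) : ℝ × ℝ :=
  (-v.2 + ∑ k ∈ Finset.range n, p k v, v.1 + ∑ k ∈ Finset.range n, q k v)

/-- The radial parts of the components on the unit circle. -/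
noncomputable def radialCoeff (p q : ℕ → C(ℝ × ℝ, ℝ)) (k : ℕ) : TurnSpace :=
  ⟨fun θ => Real.cos θ * p k (Real.cos θ, Real.sin θ) + Real.sin θ * q k (Real.cos θ, Real.sin θ),
    by fun_prop⟩

/-- The angular parts of the components on the unit circle. -/
noncomputable def angularCoeff (p q : ℕ → C(ℝ × ℝ, ℝ)) (k : ℕ) : TurnSpace :=
  ⟨fun θ => Real.cos θ * q k (Real.cos θ, Real.sin θ) - Real.sin θ * p k (Real.cos θ, Real.sin θ),
    by fun_prop⟩

theorem coeffSum_apply (A : ℕ → TurnSpace) (n : ℕ) (r : TurnSpace)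
    (θ : Icc (0 : ℝ) (2 * Real.pi)) :
    coeffSum A n r θ = ∑ k ∈ Finset.range n, A k θ * r θ ^ k := by
  simp [coeffSum, ContinuousMap.sum_apply]

variable {p q : ℕ → C(ℝ × ℝ, ℝ)}

/-- Split the field along `(cos θ, sin θ)` and `(-sin θ, cos θ)`. Homogeneity of degree `k + 2`
turns the radial part into `r² A(r)` and the tangential part into `r (1 + r B(r))`. -/
theorem componentField_polar
    (hp : ∀ k r x y, p k (r * x, r * y) = r ^ (k + 2) * p k (x, y))
    (hq : ∀ k r x y, q k (r * x, r * y) = r ^ (k + 2) * q k (x, y))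
    (n : ℕ) (r : TurnSpace) (θ : Icc (0 : ℝ) (2 * Real.pi)) :
    componentField p q n (r θ * Real.cos θ, r θ * Real.sin θ) =
      (r θ ^ 2 * coeffSum (radialCoeff p q) n r θ * Real.cos θ
          - r θ * (1 + r θ * coeffSum (angularCoeff p q) n r θ) * Real.sin θ,
        r θ ^ 2 * coeffSum (radialCoeff p q) n r θ * Real.sin θ
          + r θ * (1 + r θ * coeffSum (angularCoeff p q) n r θ) * Real.cos θ) := by
  have hsum : ∀ P : ℕ → C(ℝ × ℝ, ℝ),
      (∀ k r x y, P k (r * x, r * y) = r ^ (k + 2) * P k (x, y)) →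
      ∑ k ∈ Finset.range n, P k (r θ * Real.cos θ, r θ * Real.sin θ) =
        r θ ^ 2 * ∑ k ∈ Finset.range n, P k (Real.cos θ, Real.sin θ) * r θ ^ k := by
    intro P hP
    rw [Finset.mul_sum]
    exact Finset.sum_congr rfl fun k _ => by rw [hP]; ring
  have hA : coeffSum (radialCoeff p q) n r θ =
      Real.cos θ * ∑ k ∈ Finset.range n, p k (Real.cos θ, Real.sin θ) * r θ ^ k
        + Real.sin θ * ∑ k ∈ Finset.range n, q k (Real.cos θ, Real.sin θ) * r θ ^ k := by
    rw [coeffSum_apply, Finset.mul_sum, Finset.mul_sum, ← Finset.sum_add_distrib]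
    exact Finset.sum_congr rfl fun k _ => by simp only [radialCoeff, ContinuousMap.coe_mk]; ring
  have hB : coeffSum (angularCoeff p q) n r θ =
      Real.cos θ * ∑ k ∈ Finset.range n, q k (Real.cos θ, Real.sin θ) * r θ ^ k
        - Real.sin θ * ∑ k ∈ Finset.range n, p k (Real.cos θ, Real.sin θ) * r θ ^ k := by
    rw [coeffSum_apply, Finset.mul_sum, Finset.mul_sum, ← Finset.sum_sub_distrib]
    exact Finset.sum_congr rfl fun k _ => by simp only [angularCoeff, ContinuousMap.coe_mk]; ring
  simp only [componentField]
  rw [hsum p hp, hsum q hq, hA, hB]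
  generalize ∑ k ∈ Finset.range n, p k (Real.cos θ, Real.sin θ) * r θ ^ k = X
  generalize ∑ k ∈ Finset.range n, q k (Real.cos θ, Real.sin θ) * r θ ^ k = Y
  have hsq := Real.sin_sq_add_cos_sq (θ : ℝ)
  ext
  · linear_combination (-(r θ ^ 2 * X)) * hsq
  · linear_combination (-(r θ ^ 2 * Y)) * hsq

theorem contDiff_componentField (n : ℕ) (hp : ∀ k, ContDiff ℝ 1 (p k))
    (hq : ∀ k, ContDiff ℝ 1 (q k)) : ContDiff ℝ 1 (componentField p q n) :=
  (contDiff_snd.neg.add (ContDiff.sum fun k _ => hp k)).prodMk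
    (contDiff_fst.add (ContDiff.sum fun k _ => hq k))

/-- A solution of the fixed point equation close to `1` gives a first return. -/
theorem isFirstReturn_of_fixedPoint
    (hp : ∀ k r x y, p k (r * x, r * y) = r ^ (k + 2) * p k (x, y))
    (hq : ∀ k r x y, q k (r * x, r * y) = r ^ (k + 2) * q k (x, y))
    (n : ℕ) {s : ℝ} (hs : s ≠ 0) {η : TurnSpace} (hη : ‖η - 1‖ < 1)
    (hD : ‖s • η * coeffSum (angularCoeff p q) n (s • η)‖ ≤ 1 / 2)
    (heq : η = 1 + s • turnPrimitive
      (η ^ 2 * radialRatio (radialCoeff p q) (angularCoeff p q) n (s • η))) :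
    IsFirstReturn (componentField p q n) s (s * η turnEnd) := by
  set A := radialCoeff p q
  set B := angularCoeff p q
  set κ := η ^ 2 * radialRatio A B n (s • η) with hκ
  set w := s • η * coeffSum B n (s • η) with hw
  have hbound : ∀ θ, |turnExtend w θ| ≤ 1 / 2 := fun θ => (norm_turnExtend_le w θ).trans hD
  -- `η` lives on one turn only; the integral formula extends `sη` to a radius differentiable on the
  -- whole line.
  have hR : ∀ θ, HasDerivAt (fun θ => s * (1 + s * ∫ u in (0 : ℝ)..θ, turnExtend κ u))
      (s * (s * turnExtend κ θ)) θ := fun θ =>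
    (((hasDerivAt_integral_turnExtend κ θ).const_mul s).const_add 1).const_mul s
  have hval : ∀ θ (hθ : θ ∈ Icc 0 (2 * Real.pi)),
      1 + s * ∫ u in (0 : ℝ)..θ, turnExtend κ u = η ⟨θ, hθ⟩ := fun θ hθ => by
    conv_rhs => rw [heq]
    simp [turnPrimitive_apply]
  have hη0 : ∀ θ, 0 < η θ := fun θ => by
    have := (ContinuousMap.norm_coe_le_norm (η - 1) θ).trans_lt hη
    simp only [ContinuousMap.sub_apply, ContinuousMap.one_apply, Real.norm_eq_abs] at this
    linarith [(abs_lt.1 this).1]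
  -- Smallness of `w` makes `1 + w` a unit, so `Ring.inverse` is a genuine inverse and not its
  -- default value.
  have hunit : Ring.inverse (1 + w) * (1 + w) = 1 := by
    refine Ring.inverse_mul_cancel _ ?_
    have : ‖-w‖ < 1 := by rw [norm_neg]; linarith
    simpa using isUnit_one_sub_of_norm_lt_one this
  have hfin := isFirstReturn_of_polar (f := componentField p q n) (s := s)
    (R := fun θ => s * (1 + s * ∫ u in (0 : ℝ)..θ, turnExtend κ u))
    (R' := fun θ => s * (s * turnExtend κ θ)) (D := fun θ => 1 + turnExtend w θ)
    (by simp) (by fun_prop) (fun θ => by linarith [(abs_le.1 (hbound θ)).1])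
    (fun θ => by linarith [(abs_le.1 (hbound θ)).2]) hR
    (fun θ hθ => by
      rw [hval θ hθ, ← mul_assoc]
      exact mul_pos (mul_self_pos.2 hs) (hη0 _))
    (fun θ hθ => by
      have hpol := componentField_polar hp hq n (s • η) ⟨θ, hθ⟩
      have hu := congrArg (fun g : TurnSpace => g ⟨θ, hθ⟩) hunit
      simp only [ContinuousMap.mul_apply, ContinuousMap.add_apply, ContinuousMap.one_apply] at hu
      simp only [hval θ hθ, turnExtend_of_mem _ hθ, ContinuousMap.smul_apply, smul_eq_mul]
        at hpol ⊢
      rw [hpol]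
      have hκθ : κ ⟨θ, hθ⟩ * (1 + w ⟨θ, hθ⟩) = η ⟨θ, hθ⟩ ^ 2 * coeffSum A n (s • η) ⟨θ, hθ⟩ := by
        simp only [hκ, radialRatio, ← hw, ContinuousMap.mul_apply, ContinuousMap.pow_apply]
        linear_combination (η ⟨θ, hθ⟩ ^ 2 * coeffSum A n (s • η) ⟨θ, hθ⟩) * hu
      have hwθ : w ⟨θ, hθ⟩ = s * η ⟨θ, hθ⟩ * coeffSum B n (s • η) ⟨θ, hθ⟩ := by
        simp [hw, mul_assoc]
      ext
      · simp only
        linear_combination (-(s ^ 2 * Real.cos θ)) * hκθ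
          + s * η ⟨θ, hθ⟩ * Real.sin θ * hwθ
      · simp only
        linear_combination (-(s ^ 2 * Real.sin θ)) * hκθ
          - s * η ⟨θ, hθ⟩ * Real.cos θ * hwθ)
  rwa [hval _ ⟨Real.two_pi_pos.le, le_rfl⟩] at hfin

/-- In the Leibniz formula only the term with two derivatives on `s²` survives at `0`, with
coefficient `3 · 2`. -/
theorem iteratedDeriv_three_sq_mul {k : ℝ → ℝ} (hk : ContDiffAt ℝ 3 k 0) :
    iteratedDeriv 3 (fun s => s ^ 2 * k s) 0 = 6 * deriv k 0 := by
  rw [iteratedDeriv_fun_mul (by fun_prop) hk]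
  simp only [Finset.sum_range_succ, iteratedDeriv_fun_pow_zero]
  norm_num [Nat.choose, Nat.factorial, iteratedDeriv_one]

/-- The Liapunov number of a field with homogeneous components whose averaged quadratic radial
part vanishes. -/
theorem liapunovNumber_componentField (n : ℕ) (hpc : ∀ k, ContDiff ℝ 1 (p k))
    (hqc : ∀ k, ContDiff ℝ 1 (q k))
    (hp : ∀ k r x y, p k (r * x, r * y) = r ^ (k + 2) * p k (x, y))
    (hq : ∀ k r x y, q k (r * x, r * y) = r ^ (k + 2) * q k (x, y))
    (h0 : turnPrimitive (radialCoeff p q 0) turnEnd = 0) :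
    LiapunovNumberExists (componentField p q (n + 2)) ∧
      liapunovNumber (componentField p q (n + 2)) =
        6 * turnPrimitive (radialCoeff p q 1 - radialCoeff p q 0 * angularCoeff p q 0)
          turnEnd := by
  set f := componentField p q (n + 2)
  set A := radialCoeff p q
  set B := angularCoeff p q
  obtain ⟨η, hη, hη0, heq⟩ := exists_fixedPoint_branch A B (n + 2) turnPrimitive
  obtain ⟨hKc, hK0, hKd⟩ := branch_integrand A B n turnPrimitive hη hη0 heq
  set K : ℝ → TurnSpace := fun s => η s ^ 2 * radialRatio A B (n + 2) (s • η s) with hK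
  have huniq := fun {s t₁ t₂ : ℝ} => IsFirstReturn.unique (s := s) (t₁ := t₁) (t₂ := t₂)
    (contDiff_componentField (n + 2) hpc hqc)
  have hret : ∀ᶠ s in 𝓝 (0 : ℝ), s ≠ 0 → IsFirstReturn f s (s * η s turnEnd) := by
    have h1 : ∀ᶠ s in 𝓝 (0 : ℝ), ‖η s - 1‖ < 1 := by
      have : ContinuousAt (fun s => ‖η s - 1‖) 0 := (hη.continuousAt.sub continuousAt_const).norm
      exact this.eventually_lt continuousAt_const (by simp [hη0])
    have h2 : ∀ᶠ s in 𝓝 (0 : ℝ), ‖s • η s * coeffSum B (n + 2) (s • η s)‖ < 1 / 2 := by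
      have hs : ContinuousAt (fun s : ℝ => s • η s) 0 := continuousAt_id.smul hη.continuousAt
      have hc : ContinuousAt (fun s : ℝ => coeffSum B (n + 2) (s • η s)) 0 :=
        (contDiff_coeffSum B (n + 2)).continuous.continuousAt.comp hs
      exact (hs.mul hc).norm.eventually_lt continuousAt_const (by simp)
    filter_upwards [h1, h2, heq] with s hs1 hs2 hs3 hs
    exact isFirstReturn_of_fixedPoint hp hq (n + 2) hs hs1 hs2.le hs3
  have hP : ∀ᶠ s in 𝓝 (0 : ℝ), poincareMap f s = s * η s turnEnd := by
    filter_upwards [hret] with s hs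
    -- No return satisfies `0 < s * t` at `s = 0`, so the default value `0` of the Poincaré map
    -- applies there.
    by_cases h : s = 0
    · subst h
      rw [poincareMap, dif_neg, zero_mul]
      rintro ⟨t, ht, -⟩
      simp at ht
    · have hex : ∃ t, IsFirstReturn f s t := ⟨_, hs h⟩
      rw [poincareMap, dif_pos hex]
      exact huniq hex.choose_spec (hs h)
  have hev : ∀ g : TurnSpace, (ContinuousMap.evalCLM ℝ turnEnd) g = g turnEnd := fun _ => rfl
  have hηc : ContDiffAt ℝ 4 (fun s => η s turnEnd) 0 :=
    (ContinuousMap.evalCLM ℝ turnEnd).contDiff.contDiffAt.fun_comp (0 : ℝ) hη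
  refine ⟨⟨?_, ?_⟩, ?_⟩
  · rw [eventually_nhdsWithin_iff]
    exact hret.mono fun s hs h => ⟨_, hs h, fun t ht => huniq ht (hs h)⟩
  · exact ((contDiffAt_fun_id.mul hηc).of_le (by norm_num)).congr_of_eventuallyEq hP
  · set L : TurnSpace →L[ℝ] ℝ := (ContinuousMap.evalCLM ℝ turnEnd).comp turnPrimitive with hL
    have hd : (fun s => poincareMap f s - s) =ᶠ[𝓝 0] fun s => s ^ 2 * L (K s) := by
      filter_upwards [hP, heq] with s hs1 hs2
      have h := congrArg (fun g : TurnSpace => g turnEnd) hs2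
      simp only [ContinuousMap.add_apply, ContinuousMap.one_apply, ContinuousMap.smul_apply,
        smul_eq_mul] at h
      rw [hs1, h]
      simp only [hL, ContinuousLinearMap.comp_apply, hev, hK]
      ring
    have hLK : HasDerivAt (fun s => L (K s))
        (L (2 * (turnPrimitive (A 0) * A 0) + (A 1 - A 0 * B 0))) 0 :=
      L.hasFDerivAt.comp_hasDerivAt (0 : ℝ) hKd
    rw [liapunovNumber, hd.iteratedDeriv_eq, iteratedDeriv_three_sq_mul, hLK.deriv, map_add]
    · have hz : L (2 * (turnPrimitive (A 0) * A 0)) = 0 := by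
        rw [hL, ContinuousLinearMap.comp_apply, hev, turnPrimitive_primitive_mul_self, h0]
        norm_num
      rw [hz, zero_add]
      rfl
    · exact (L.contDiff.contDiffAt.fun_comp (0 : ℝ) hKc).of_le (by norm_num)

end Components

/-! ## The Liapunov number in terms of coefficients -/

/-- A homogeneous form `∑ c_j x ^ i y ^ j` of two variables as a continuous function. -/
noncomputable def binaryForm (c : ℕ → ℕ → ℝ) (d : ℕ) : C(ℝ × ℝ, ℝ) :=
  ⟨fun v => ∑ ij ∈ Finset.HasAntidiagonal.antidiagonal d, c ij.1 ij.2 * (v.1 ^ ij.1 * v.2 ^ ij.2), by fun_prop⟩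

theorem binaryForm_apply (c : ℕ → ℕ → ℝ) (d : ℕ) (v : ℝ × ℝ) :
    binaryForm c d v = ∑ ij ∈ Finset.HasAntidiagonal.antidiagonal d, c ij.1 ij.2 * (v.1 ^ ij.1 * v.2 ^ ij.2) :=
  rfl

theorem contDiff_binaryForm (c : ℕ → ℕ → ℝ) (d : ℕ) : ContDiff ℝ 1 (binaryForm c d) := by
  change ContDiff ℝ 1 fun v : ℝ × ℝ => ∑ ij ∈ Finset.HasAntidiagonal.antidiagonal d,
    c ij.1 ij.2 * (v.1 ^ ij.1 * v.2 ^ ij.2)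
  fun_prop

theorem binaryForm_mul (c : ℕ → ℕ → ℝ) (d : ℕ) (r x y : ℝ) :
    binaryForm c d (r * x, r * y) = r ^ d * binaryForm c d (x, y) := by
  rw [binaryForm_apply, binaryForm_apply, Finset.mul_sum]
  refine Finset.sum_congr rfl fun ij hij => ?_
  rw [← Finset.HasAntidiagonal.mem_antidiagonal.1 hij]
  ring

/-- The trigonometric part is periodic, so a full turn contributes `π/4`, the only source of `π` in
the Liapunov number. -/
theorem hasDerivAt_sin_sq_mul_cos_sq_primitive (θ : ℝ) :
    HasDerivAt (fun θ => θ / 8 + Real.sin θ * Real.cos θ * (Real.sin θ ^ 2 - Real.cos θ ^ 2) / 8)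
      (Real.cos θ ^ 2 * Real.sin θ ^ 2) θ := by
  have hs := Real.hasDerivAt_sin θ
  have hc := Real.hasDerivAt_cos θ
  refine (((hasDerivAt_id θ).div_const 8).add
    (((hs.mul hc).mul ((hs.pow 2).sub (hc.pow 2))).div_const 8)).congr_deriv ?_
  have h := Real.sin_sq_add_cos_sq θ
  simp only [Pi.mul_apply, Pi.sub_apply, Pi.pow_apply]
  grind

/-- The Liapunov number of the field
`x' = -y + a xy + b y² + l x²y + m xy² + k y³ + ⋯, y' = x + 2xy + y²`. -/
theorem liapunovNumber_binaryForm (n : ℕ) (c e : ℕ → ℕ → ℝ)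
    (hc2 : c 2 0 = 0) (hc3 : c 3 0 = 0) (he20 : e 2 0 = 0) (he11 : e 1 1 = 2) (he02 : e 0 2 = 1)
    (he3 : ∀ i j, i + j = 3 → e i j = 0) :
    LiapunovNumberExists
        (componentField (fun k => binaryForm c (k + 2)) (fun k => binaryForm e (k + 2)) (n + 2)) ∧
      liapunovNumber
        (componentField (fun k => binaryForm c (k + 2)) (fun k => binaryForm e (k + 2)) (n + 2)) =
        3 * Real.pi / 2 * (c 1 1 * c 0 2 + 2 * c 0 2 + c 1 2 - 2) := by
  set p := fun k => binaryForm c (k + 2)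
  set q := fun k => binaryForm e (k + 2)
  have hp0 : ∀ x y, p 0 (x, y) = c 1 1 * (x * y) + c 0 2 * y ^ 2 := fun x y => by
    simp [p, binaryForm_apply, Finset.Nat.antidiagonal_succ, hc2]
    ring
  have hq0 : ∀ x y, q 0 (x, y) = 2 * (x * y) + y ^ 2 := fun x y => by
    simp [q, binaryForm_apply, Finset.Nat.antidiagonal_succ, he20, he11, he02]
    ring
  have hp1 : ∀ x y, p 1 (x, y) = c 2 1 * (x ^ 2 * y) + c 1 2 * (x * y ^ 2) + c 0 3 * y ^ 3 :=
    fun x y => by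
      simp [p, binaryForm_apply, Finset.Nat.antidiagonal_succ, hc3]
      ring
  have hq1 : ∀ x y, q 1 (x, y) = 0 := fun x y => by
    simp [q, binaryForm_apply, Finset.Nat.antidiagonal_succ, he3]
  -- A cubic form in `cos θ`, `sin θ` has a periodic primitive, so its mean is zero.
  have hA0 : turnPrimitive (radialCoeff p q 0) turnEnd = 0 := by
    rw [turnPrimitive_turnEnd_eq_sub
      (F := fun θ => -(c 1 1 / 3) * Real.cos θ ^ 3 + (c 0 2 + 2) / 3 * Real.sin θ ^ 3
        + (-Real.cos θ + 1 / 3 * Real.cos θ ^ 3))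
      (f := fun θ => c 1 1 * (Real.cos θ ^ 2 * Real.sin θ)
        + (c 0 2 + 2) * (Real.cos θ * Real.sin θ ^ 2) + Real.sin θ ^ 3) ?_ (by fun_prop) ?_]
    · simp
    · intro θ
      have hs := Real.hasDerivAt_sin θ
      have hc := Real.hasDerivAt_cos θ
      refine ((((hc.fun_pow 3).const_mul _).add ((hs.fun_pow 3).const_mul _)).add
        (hc.neg.add ((hc.fun_pow 3).const_mul _))).congr_deriv ?_
      have h := Real.sin_sq_add_cos_sq θ
      grind
    · intro θ
      simp only [radialCoeff, ContinuousMap.coe_mk, hp0, hq0]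
      ring
  obtain ⟨hex, hval⟩ := liapunovNumber_componentField (p := p) (q := q) n
    (fun k => contDiff_binaryForm c _) (fun k => contDiff_binaryForm e _)
    (fun k => binaryForm_mul c _) (fun k => binaryForm_mul e _) hA0
  refine ⟨hex, hval.trans ?_⟩
  set I : ℝ → ℝ := fun θ =>
    θ / 8 + Real.sin θ * Real.cos θ * (Real.sin θ ^ 2 - Real.cos θ ^ 2) / 8 with hI
  -- The even sextic terms reduce to `I`: `I ± sin³ cos³ / 3` have derivatives `2 cos⁴ sin²` and `2
  -- cos² sin⁴`, and `sin⁶ = 5 cos² sin⁴ - (sin⁵ cos)'`. All terms other than multiples of `I` are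
  -- periodic and drop out.
  rw [turnPrimitive_turnEnd_eq_sub
    (F := fun θ => -(c 2 1 / 4) * Real.cos θ ^ 4 + c 1 2 * I θ + c 0 3 / 4 * Real.sin θ ^ 4
      - c 1 1 * (I θ + Real.sin θ ^ 3 * Real.cos θ ^ 3 / 3)
      - (-(c 1 1 * c 0 2) + (c 0 2 + 2) * (1 - c 1 1) + 2 - 5 * c 0 2) / 2
        * (I θ - Real.sin θ ^ 3 * Real.cos θ ^ 3 / 3)
      - c 0 2 * (Real.sin θ ^ 5 * Real.cos θ)
      - (c 1 1 * (1 - c 1 1) + 2 * (c 0 2 + 2)) * (Real.sin θ ^ 4 / 4 - Real.sin θ ^ 6 / 6)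
      - (1 - c 1 1 - (c 0 2 + 2) * c 0 2) / 6 * Real.sin θ ^ 6)
    (f := fun θ => c 2 1 * (Real.cos θ ^ 3 * Real.sin θ)
      + c 1 2 * (Real.cos θ ^ 2 * Real.sin θ ^ 2) + c 0 3 * (Real.cos θ * Real.sin θ ^ 3)
      - (c 1 1 * (Real.cos θ ^ 2 * Real.sin θ) + (c 0 2 + 2) * (Real.cos θ * Real.sin θ ^ 2)
        + Real.sin θ ^ 3) * (2 * (Real.cos θ ^ 2 * Real.sin θ)
          + (1 - c 1 1) * (Real.cos θ * Real.sin θ ^ 2) - c 0 2 * Real.sin θ ^ 3))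
    ?_ (by fun_prop) ?_]
  · simp [hI]
    ring
  · intro θ
    have hs := Real.hasDerivAt_sin θ
    have hc := Real.hasDerivAt_cos θ
    have hI' := hasDerivAt_sin_sq_mul_cos_sq_primitive θ
    have h33 := ((hs.fun_pow 3).mul (hc.fun_pow 3)).div_const 3
    refine ((((((((hc.fun_pow 4).const_mul _).add (hI'.const_mul _)).add
      ((hs.fun_pow 4).const_mul _)).sub ((hI'.add h33).const_mul _)).sub
      ((hI'.sub h33).const_mul _)).sub (((hs.fun_pow 5).mul hc).const_mul _)).sub
      ((((hs.fun_pow 4).div_const 4).sub ((hs.fun_pow 6).div_const 6)).const_mul _)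
      |>.sub ((hs.fun_pow 6).const_mul _)).congr_deriv ?_
    have h := Real.sin_sq_add_cos_sq θ
    norm_num
    grind
  · intro θ
    simp only [radialCoeff, angularCoeff, ContinuousMap.sub_apply, ContinuousMap.mul_apply,
      ContinuousMap.coe_mk, hp0, hq0, hp1, hq1]
    ring

/-! ## Coefficients of the boundary polynomial -/

section Counting

variable {V W : Type*} [Fintype V] [Fintype W]

/-- The coefficient of `x ^ i y ^ j` in the boundary polynomial. -/
noncomputable def boundaryCount (G : SimpleGraph V) (i j : ℕ) : ℕ :=
  (Finset.univ.filter fun S : Finset V => (vertexBoundary G S).ncard = i ∧ S.card = j).card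

theorem boundaryCount_eq_zero {G : SimpleGraph V} {i j : ℕ}
    (h : ∀ S : Finset V, S.card = j → (vertexBoundary G S).ncard ≠ i) :
    boundaryCount G i j = 0 :=
  Finset.card_eq_zero.2 (Finset.filter_eq_empty_iff.2 fun S _ hS => h S hS.2 hS.1)

omit [Fintype V] in
theorem vertexBoundary_empty (G : SimpleGraph V) : vertexBoundary G ∅ = ∅ := by
  simp [vertexBoundary]

theorem boundaryCount_zero_right {G : SimpleGraph V} {i : ℕ} (hi : i ≠ 0) :
    boundaryCount G i 0 = 0 :=
  boundaryCount_eq_zero fun S hS => by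
    rw [Finset.card_eq_zero.1 hS, vertexBoundary_empty, ncard_empty]
    exact hi.symm

theorem card_le_card_add_ncard_vertexBoundary {G : SimpleGraph V} {S T : Finset V}
    (h : ∀ t ∈ T, t ∈ S ∨ ∃ u ∈ S, G.Adj u t) :
    T.card ≤ S.card + (vertexBoundary G S).ncard := by
  rw [← ncard_coe_finset, ← ncard_coe_finset]
  refine (ncard_le_ncard (fun t ht => ?_) (toFinite _)).trans (ncard_union_le _ _)
  by_cases hS : t ∈ S
  · exact Or.inl hS
  · exact Or.inr ⟨hS, (h t ht).resolve_left hS⟩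

theorem card_add_ncard_vertexBoundary_le (G : SimpleGraph V) (S : Finset V) :
    S.card + (vertexBoundary G S).ncard ≤ Fintype.card V := by
  rw [← ncard_coe_finset, ← ncard_union_eq, ← Nat.card_eq_fintype_card]
  · exact ncard_le_card _
  · exact disjoint_left.2 fun v hv hB => hB.1 hv

theorem binaryForm_boundaryCount (G : SimpleGraph V) (d : ℕ) (x y : ℝ) :
    binaryForm (fun i j => boundaryCount G i j) d (x, y) =
      ∑ S : Finset V with (vertexBoundary G S).ncard + S.card = d,
        x ^ (vertexBoundary G S).ncard * y ^ S.card := by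
  rw [binaryForm_apply, ← Finset.sum_fiberwise_of_maps_to
    (t := Finset.HasAntidiagonal.antidiagonal d)
    (g := fun S : Finset V => ((vertexBoundary G S).ncard, S.card))]
  · refine Finset.sum_congr rfl fun ij hij => ?_
    have hij' := Finset.HasAntidiagonal.mem_antidiagonal.1 hij
    rw [Finset.sum_congr rfl (g := fun _ => x ^ ij.1 * y ^ ij.2), Finset.sum_const, nsmul_eq_mul,
      boundaryCount]
    · congr 3
      ext S
      simp only [Finset.mem_filter, Finset.mem_univ, true_and, Prod.ext_iff]
      constructor
      · rintro ⟨h1, h2⟩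
        exact ⟨by rw [h1, h2, hij'], h1, h2⟩
      · exact fun h => h.2
    · intro S hS
      rw [← (Finset.mem_filter.1 hS).2]
  · intro S hS
    exact Finset.HasAntidiagonal.mem_antidiagonal.2 (Finset.mem_filter.1 hS).2

/-- The degree of the monomial of `S` is the size of its closed neighbourhood. For nonempty `S` this
is at least 2, as no vertex is isolated, and at most the order of `G`; the empty set accounts for
the `1`. -/
theorem boundaryPoly_sub_one {G : SimpleGraph V} (hG : ∀ v, ∃ u, G.Adj v u) {n : ℕ}
    (hn : Fintype.card V ≤ n) (x y : ℝ) :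
    boundaryPoly G x y - 1 =
      ∑ k ∈ Finset.range n, binaryForm (fun i j => boundaryCount G i j) (k + 2) (x, y) := by
  classical
  have hempty : x ^ (vertexBoundary G ∅).ncard * y ^ (∅ : Finset V).card = 1 := by
    simp [vertexBoundary_empty]
  have hdeg : ∀ S : Finset V, S.Nonempty → 2 ≤ S.card + (vertexBoundary G S).ncard := by
    rintro S ⟨v, hv⟩
    obtain ⟨u, hu⟩ := hG v
    rw [← Finset.card_pair hu.ne]
    refine card_le_card_add_ncard_vertexBoundary fun t ht => ?_
    rcases Finset.mem_insert.1 ht with rfl | ht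
    · exact Or.inl hv
    · rw [Finset.mem_singleton.1 ht]
      exact Or.inr ⟨v, hv, hu⟩
  rw [boundaryPoly, ← Finset.add_sum_erase _ _ (Finset.mem_univ ∅), hempty, add_sub_cancel_left,
    ← Finset.sum_fiberwise_of_maps_to (t := Finset.range n)
      (g := fun S : Finset V => (vertexBoundary G S).ncard + S.card - 2)]
  · refine Finset.sum_congr rfl fun k _ => ?_
    rw [binaryForm_boundaryCount]
    congr 1
    ext S
    simp only [Finset.mem_filter, Finset.mem_erase, Finset.mem_univ, and_true, true_and]
    constructor
    · rintro ⟨hS, h⟩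
      have := hdeg S (Finset.nonempty_iff_ne_empty.2 hS)
      omega
    · intro h
      refine ⟨?_, by omega⟩
      rintro rfl
      simp [vertexBoundary_empty] at h
  · intro S hS
    have h1 := hdeg S (Finset.nonempty_iff_ne_empty.2 (Finset.mem_erase.1 hS).1)
    have h2 := card_add_ncard_vertexBoundary_le G S
    rw [Finset.mem_range]
    omega

theorem boundaryPoly_congr {G : SimpleGraph V} {H : SimpleGraph W} (e : G ≃g H) (x y : ℝ) :
    boundaryPoly G x y = boundaryPoly H x y := by
  refine Fintype.sum_equiv (Equiv.finsetCongr e.toEquiv) _ _ fun S => ?_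
  have h : vertexBoundary H (Equiv.finsetCongr e.toEquiv S) = e '' vertexBoundary G S := by
    ext w
    obtain ⟨v, rfl⟩ := e.surjective w
    rw [e.injective.mem_set_image]
    have hadj : ∀ w, G.Adj (e.symm w) v ↔ H.Adj w (e v) := fun w => by
      rw [← e.map_adj_iff, e.apply_symm_apply]
    simp only [vertexBoundary, mem_ofPred_eq, Equiv.finsetCongr_apply, Finset.mem_map_equiv,
      e.symm.surjective.exists, hadj]
    exact and_congr_left' (not_congr (iff_of_eq (congrArg (· ∈ S) (e.symm_apply_apply v))))
  rw [h, ncard_image_of_injective _ e.injective]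
  simp

theorem boundaryField_congr {V' W' : Type*} [Fintype V'] [Fintype W'] {G : SimpleGraph V}
    {H : SimpleGraph W} {G' : SimpleGraph V'} {H' : SimpleGraph W'} (e : G ≃g H) (e' : G' ≃g H')
    (α : ℝ) : boundaryField α G G' = boundaryField α H H' := by
  funext v
  simp only [boundaryField, boundaryPoly_congr e, boundaryPoly_congr e']

end Counting

/-! ## Counting in complete graphs, stars, cycles and wheels -/

theorem ncard_vertexBoundary_top {n : ℕ} {S : Finset (Fin n)} (hS : S.Nonempty) :
    (vertexBoundary (⊤ : SimpleGraph (Fin n)) S).ncard = n - S.card := by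
  have h : vertexBoundary (⊤ : SimpleGraph (Fin n)) S = ((Sᶜ : Finset (Fin n)) : Set (Fin n)) := by
    ext v
    simp only [vertexBoundary, mem_ofPred_eq, SimpleGraph.top_adj, Finset.coe_compl, mem_compl_iff,
      Finset.mem_coe, and_iff_left_iff_imp]
    obtain ⟨u, hu⟩ := hS
    exact fun hv => ⟨u, hu, fun huv => hv (huv ▸ hu)⟩
  rw [h, ncard_coe_finset, Finset.card_compl, Fintype.card_fin]

theorem boundaryCount_top {n i j : ℕ} (hj : j ≠ 0) :
    boundaryCount (⊤ : SimpleGraph (Fin n)) i j = if i + j = n then n.choose j else 0 := by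
  have hne : ∀ S : Finset (Fin n), S.card = j → S.Nonempty := fun S hS =>
    Finset.card_pos.1 (by omega)
  have hle : ∀ S : Finset (Fin n), S.card ≤ n := fun S => by simpa using S.card_le_univ
  split_ifs with h
  · rw [boundaryCount, ← Finset.card_fin n, ← Finset.card_powersetCard, Finset.card_fin]
    congr 1
    ext S
    simp only [Finset.mem_filter, Finset.mem_univ, true_and, Finset.mem_powersetCard,
      Finset.subset_univ, and_iff_right_iff_imp]
    intro hS
    rw [ncard_vertexBoundary_top (hne S hS)]
    omega
  · refine boundaryCount_eq_zero fun S hS => ?_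
    rw [ncard_vertexBoundary_top (hne S hS)]
    have := hle S
    omega

theorem starGraph_two : starGraph 2 = ⊤ := by
  ext i j
  simp only [starGraph, SimpleGraph.top_adj]
  omega

/-- A pair of leaves has only the hub in its boundary. For `n ≥ 4` there are at least three such
pairs; for `n = 3` the two pairs containing the hub also qualify, their boundary being the other
leaf. -/
theorem three_le_boundaryCount_starGraph {n : ℕ} (hn : 3 ≤ n) :
    3 ≤ boundaryCount (starGraph n) 1 2 := by
  obtain ⟨m, rfl⟩ := Nat.exists_eq_add_of_le' hn
  have hleaf : ∀ S : Finset (Fin (m + 3)), 0 ∉ S → S.Nonempty →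
      (vertexBoundary (starGraph (m + 3)) S).ncard = 1 := by
    rintro S h0 ⟨u, hu⟩
    rw [ncard_eq_one]
    refine ⟨0, ?_⟩
    ext v
    simp only [vertexBoundary, starGraph, mem_ofPred_eq, mem_singleton_iff]
    constructor
    · rintro ⟨hv, w, hw, -, h | h⟩
      · exact absurd ((Fin.ext h : w = 0) ▸ hw) h0
      · exact Fin.ext h
    · rintro rfl
      exact ⟨h0, u, hu, fun h => h0 (h ▸ hu), Or.inr rfl⟩
  rcases Nat.eq_zero_or_pos m with rfl | hm
  · have hhub : ∀ S : Finset (Fin 3), 0 ∈ S →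
        (vertexBoundary (starGraph 3) S).ncard = 3 - S.card := by
      intro S h0
      rw [← ncard_vertexBoundary_top ⟨0, h0⟩]
      congr 1
      ext v
      simp only [vertexBoundary, starGraph, mem_ofPred_eq, SimpleGraph.top_adj]
      refine and_congr_right fun hv => ⟨fun ⟨u, hu, h⟩ => ⟨u, hu, h.1⟩, fun _ => ?_⟩
      exact ⟨0, h0, fun h => hv (h ▸ h0), Or.inl rfl⟩
    refine le_of_eq_of_le (b := (Finset.powersetCard 2 (Finset.univ : Finset (Fin 3))).card)
      (by simp) (Finset.card_le_card fun S hS => ?_)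
    have hS := (Finset.mem_powersetCard.1 hS).2
    refine Finset.mem_filter.2 ⟨Finset.mem_univ _, ?_, hS⟩
    by_cases h0 : 0 ∈ S
    · rw [hhub S h0, hS]
    · exact hleaf S h0 (Finset.card_pos.1 (by omega))
  · refine le_trans (b := (Finset.powersetCard 2
      ((Finset.univ : Finset (Fin (m + 3))).erase 0)).card) ?_ (Finset.card_le_card fun S hS => ?_)
    · rw [Finset.card_powersetCard, Finset.card_erase_of_mem (Finset.mem_univ _), Finset.card_fin]
      exact Nat.choose_le_choose (a := 3) 2 (by omega)
    · obtain ⟨hsub, hS⟩ := Finset.mem_powersetCard.1 hS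
      exact Finset.mem_filter.2 ⟨Finset.mem_univ _, hleaf S (fun h0 => by simpa using hsub h0)
        (Finset.card_pos.1 (by omega)), hS⟩

/-- An adjacent pair `w, w + 1` reaches the four consecutive vertices from `w - 1` to `w + 2`,
distinct as `n ≥ 4`. For a nonadjacent pair, take one vertex, its two neighbours and the other
vertex. -/
theorem four_le_closedNeighborhood_cycleGraph {n : ℕ} (hn : 4 ≤ n) {S : Finset (Fin n)}
    (hS : S.card = 2) : 4 ≤ S.card + (vertexBoundary (SimpleGraph.cycleGraph n) S).ncard := by
  obtain ⟨m, rfl⟩ := Nat.exists_eq_add_of_le' hn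
  have hnext : ∀ w : Fin (m + 4), (SimpleGraph.cycleGraph (m + 4)).Adj w (w + 1) := fun w => by
    rw [SimpleGraph.cycleGraph_adj]
    simp
  have hprev : ∀ w : Fin (m + 4), (SimpleGraph.cycleGraph (m + 4)).Adj w (w - 1) := fun w => by
    rw [SimpleGraph.cycleGraph_adj]
    simp
  have hadj : ∀ w ∈ S, w + 1 ∈ S →
      4 ≤ S.card + (vertexBoundary (SimpleGraph.cycleGraph (m + 4)) S).ncard := by
    intro w hw hw1
    have hinj : Function.Injective fun k : Fin 4 => w - 1 + Fin.castLE hn k :=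
      (add_right_injective (w - 1)).comp (Fin.castLE_injective hn)
    refine le_of_eq_of_le ?_ (card_le_card_add_ncard_vertexBoundary
      (T := Finset.univ.map ⟨_, hinj⟩) fun t ht => ?_)
    · simp
    · obtain ⟨k, -, rfl⟩ := Finset.mem_map.1 ht
      simp only [Function.Embedding.coeFn_mk]
      have h2 : w - 1 + Fin.castLE hn 2 = w + 1 := by
        rw [show Fin.castLE hn 2 = (1 + 1 : Fin (m + 4)) from rfl]
        abel
      have h3 : w - 1 + Fin.castLE hn 3 = w + 1 + 1 := by
        rw [show Fin.castLE hn 3 = (1 + 1 + 1 : Fin (m + 4)) from rfl]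
        abel
      fin_cases k
      · right
        refine ⟨w, hw, ?_⟩
        simpa using hprev w
      · left
        rw [show Fin.castLE hn ((fun i => i) ⟨1, by norm_num⟩) = (1 : Fin (m + 4)) from rfl]
        simpa using hw
      · left
        exact h2 ▸ hw1
      · right
        exact ⟨w + 1, hw1, h3 ▸ hnext _⟩
  obtain ⟨u, v, huv, rfl⟩ := Finset.card_eq_two.1 hS
  by_cases h1 : v = u + 1
  · subst h1
    exact hadj u (by simp) (by simp)
  by_cases h2 : v = u - 1
  · subst h2
    exact hadj (u - 1) (by simp) (by simp)
  · refine le_of_eq_of_le ?_ (card_le_card_add_ncard_vertexBoundary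
      (T := insert v (insert u ((SimpleGraph.cycleGraph (m + 4)).neighborFinset u)))
      fun t ht => ?_)
    · rw [Finset.card_insert_of_notMem, Finset.card_insert_of_notMem,
        SimpleGraph.card_neighborFinset_eq_degree, SimpleGraph.cycleGraph_degree_three_le]
      · simp
      · rw [SimpleGraph.cycleGraph_neighborFinset]
        simp [huv.symm, h1, h2]
    · simp only [Finset.mem_insert, SimpleGraph.mem_neighborFinset] at ht
      rcases ht with rfl | rfl | ht
      · simp
      · simp
      · exact Or.inr ⟨u, by simp, ht⟩

/-- One vertex of `S` suffices: the hub reaches everything, and a rim vertex reaches the hub and its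
two rim neighbours. -/
theorem four_le_closedNeighborhood_wheelGraph {n : ℕ} (hn : 4 ≤ n)
    {S : Finset (Option (Fin (n - 1)))} (hS : S.Nonempty) :
    4 ≤ S.card + (vertexBoundary (wheelGraph n) S).ncard := by
  obtain ⟨m, rfl⟩ := Nat.exists_eq_add_of_le' hn
  obtain ⟨v, hv⟩ := hS
  rcases v with _ | i
  · refine le_trans ?_ (card_le_card_add_ncard_vertexBoundary (T := Finset.univ) fun t _ => ?_)
    · simp
    · rcases t with _ | i
      · exact Or.inl hv
      · exact Or.inr ⟨none, hv, trivial⟩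
  · change Fin (m + 3) at i
    refine le_of_eq_of_le ?_ (card_le_card_add_ncard_vertexBoundary
      (T := Finset.insertNone
        (insert i ((SimpleGraph.cycleGraph (m + 3)).neighborFinset i))) fun t ht => ?_)
    · rw [Finset.card_insertNone, Finset.card_insert_of_notMem (by simp),
        SimpleGraph.card_neighborFinset_eq_degree, SimpleGraph.cycleGraph_degree_three_le]
    · rcases t with _ | j
      · exact Or.inr ⟨some i, hv, trivial⟩
      · rw [Finset.some_mem_insertNone, Finset.mem_insert, SimpleGraph.mem_neighborFinset] at ht
        rcases ht with rfl | ht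
        · exact Or.inl hv
        · exact Or.inr ⟨some i, hv, ht⟩

/-! ## The Liapunov number for `G₂ = P₂` -/

theorem sigmaB_complete_two {V : Type*} [Fintype V] {G : SimpleGraph V}
    (hG : ∀ v, ∃ u, G.Adj v u) :
    LiapunovNumberExists (boundaryField 0 G (⊤ : SimpleGraph (Fin 2))) ∧
      sigmaB G (⊤ : SimpleGraph (Fin 2)) = 3 * Real.pi / 2 *
        (boundaryCount G 1 1 * boundaryCount G 0 2 + 2 * boundaryCount G 0 2
          + boundaryCount G 1 2 - 2) := by
  have htop : ∀ v : Fin 2, ∃ u, (⊤ : SimpleGraph (Fin 2)).Adj v u := by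
    intro v
    exact ⟨v + 1, by simp⟩
  -- Components of degree above the order of a graph vanish, so both polynomials can be padded to
  -- the same length, with the quadratic and cubic ones always included.
  have hfield : boundaryField 0 G (⊤ : SimpleGraph (Fin 2)) =
      componentField (fun k => binaryForm (fun i j => boundaryCount G i j) (k + 2))
        (fun k => binaryForm
          (fun i j => boundaryCount (⊤ : SimpleGraph (Fin 2)) i j) (k + 2))
        (Fintype.card V + 2) := by
    funext v
    have h1 := boundaryPoly_sub_one hG (Nat.le_add_right (Fintype.card V) 2) v.1 v.2
    have h2 := boundaryPoly_sub_one htop (n := Fintype.card V + 2) (by simp) v.1 v.2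
    rw [componentField, ← h1, ← h2, boundaryField]
    ext <;> simp only <;> ring
  rw [sigmaB, hfield]
  refine liapunovNumber_binaryForm _ _ _ ?_ ?_ ?_ ?_ ?_ ?_
  · simp [boundaryCount_zero_right]
  · simp [boundaryCount_zero_right]
  · simp [boundaryCount_zero_right]
  · simp [boundaryCount_top]
  · simp [boundaryCount_top]
  · intro i j hij
    rcases Nat.eq_zero_or_pos j with rfl | hj
    · rw [boundaryCount_zero_right (by omega), Nat.cast_zero]
    · rw [boundaryCount_top hj.ne', if_neg (by omega), Nat.cast_zero]

/-- The sign of `σ_B` for a graph without isolated vertices is governed by the numbers of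
vertices of degree one and of pairs of vertices with small boundary. -/
theorem sigmaB_neg_of_four_le {V : Type*} [Fintype V] {G : SimpleGraph V}
    (hG : ∀ v, ∃ u, G.Adj v u)
    (h : ∀ S : Finset V, S.card = 2 → 4 ≤ S.card + (vertexBoundary G S).ncard) :
    LiapunovNumberExists (boundaryField 0 G (⊤ : SimpleGraph (Fin 2))) ∧
      sigmaB G (⊤ : SimpleGraph (Fin 2)) < 0 := by
  obtain ⟨hex, hval⟩ := sigmaB_complete_two hG
  refine ⟨hex, ?_⟩
  rw [hval, boundaryCount_eq_zero (i := 0) (j := 2) fun S hS h0 => by have := h S hS; omega,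
    boundaryCount_eq_zero (i := 1) (j := 2) fun S hS h0 => by have := h S hS; omega]
  have := Real.pi_pos
  simp only [Nat.cast_zero]
  linarith

theorem sigmaB_pos_of_two_lt {V : Type*} [Fintype V] {G : SimpleGraph V}
    (hG : ∀ v, ∃ u, G.Adj v u)
    (h : 2 < boundaryCount G 1 1 * boundaryCount G 0 2 + 2 * boundaryCount G 0 2
      + boundaryCount G 1 2) :
    LiapunovNumberExists (boundaryField 0 G (⊤ : SimpleGraph (Fin 2))) ∧
      0 < sigmaB G (⊤ : SimpleGraph (Fin 2)) := by
  obtain ⟨hex, hval⟩ := sigmaB_complete_two hG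
  refine ⟨hex, ?_⟩
  rw [hval]
  have h' : (2 : ℝ) < boundaryCount G 1 1 * boundaryCount G 0 2 + 2 * boundaryCount G 0 2
      + boundaryCount G 1 2 := by exact_mod_cast h
  exact mul_pos (by have := Real.pi_pos; positivity) (by linarith)

theorem exists_adj_top {n : ℕ} (hn : 2 ≤ n) (v : Fin n) :
    ∃ u, (⊤ : SimpleGraph (Fin n)).Adj v u := by
  have : Nontrivial (Fin n) := Fin.nontrivial_iff_two_le.2 hn
  obtain ⟨u, hu⟩ := exists_ne v
  exact ⟨u, hu.symm⟩

theorem exists_adj_starGraph {n : ℕ} (hn : 2 ≤ n) (v : Fin n) :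
    ∃ u, (starGraph n).Adj v u := by
  by_cases hv : v.val = 0
  · exact ⟨⟨1, hn⟩, fun h => by simp [h] at hv, Or.inl hv⟩
  · exact ⟨⟨0, by omega⟩, fun h => hv (by rw [h]), Or.inr rfl⟩

theorem exists_adj_cycleGraph {n : ℕ} (hn : 2 ≤ n) (v : Fin n) :
    ∃ u, (SimpleGraph.cycleGraph n).Adj v u := by
  obtain ⟨m, rfl⟩ := Nat.exists_eq_add_of_le' hn
  exact ⟨v + 1, by rw [SimpleGraph.cycleGraph_adj]; simp⟩

theorem exists_adj_wheelGraph {n : ℕ} (hn : 2 ≤ n) (v : Option (Fin (n - 1))) :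
    ∃ u, (wheelGraph n).Adj v u := by
  rcases v with _ | i
  · exact ⟨some ⟨0, by omega⟩, trivial⟩
  · exact ⟨none, trivial⟩

theorem corollary3p8 {V₁ V₂ : Type*} [Fintype V₁] [Fintype V₂]
    (G₁ : SimpleGraph V₁) (G₂ : SimpleGraph V₂)
    (hG₂ : Nonempty (G₂ ≃g SimpleGraph.pathGraph 2)) :
    ((Nonempty (G₁ ≃g (⊤ : SimpleGraph (Fin 3))) ∨
        Nonempty (G₁ ≃g SimpleGraph.cycleGraph 3) ∨
        ∃ n : ℕ, 2 ≤ n ∧ Nonempty (G₁ ≃g starGraph n)) →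
      LiapunovNumberExists (boundaryField 0 G₁ G₂) ∧ 0 < sigmaB G₁ G₂) ∧
    ((∃ n : ℕ, 4 ≤ n ∧
        (Nonempty (G₁ ≃g (⊤ : SimpleGraph (Fin n))) ∨
          Nonempty (G₁ ≃g SimpleGraph.cycleGraph n) ∨
          Nonempty (G₁ ≃g wheelGraph n))) →
      LiapunovNumberExists (boundaryField 0 G₁ G₂) ∧ sigmaB G₁ G₂ < 0) := by
  rw [SimpleGraph.pathGraph_two_eq_top] at hG₂
  obtain ⟨e₂⟩ := hG₂
  rw [sigmaB]
  have hK₃ : ∀ e : G₁ ≃g (⊤ : SimpleGraph (Fin 3)),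
      LiapunovNumberExists (boundaryField 0 G₁ G₂) ∧
        0 < liapunovNumber (boundaryField 0 G₁ G₂) := fun e => by
    rw [boundaryField_congr e e₂]
    refine sigmaB_pos_of_two_lt (exists_adj_top (by norm_num)) ?_
    simp [boundaryCount_top]
  refine ⟨?_, ?_⟩
  · rintro (⟨⟨e⟩⟩ | ⟨⟨e⟩⟩ | ⟨n, hn, ⟨e⟩⟩)
    · exact hK₃ e
    · rw [SimpleGraph.cycleGraph_three_eq_top] at e
      exact hK₃ e
    · rw [boundaryField_congr e e₂]
      refine sigmaB_pos_of_two_lt (exists_adj_starGraph hn) ?_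
      -- `S_2 = K_2` has no pairs with one boundary vertex; there `b_11 = 2` and `b_02 = 1` give the
      -- value `4 > 2`.
      rcases hn.eq_or_lt with rfl | hn
      · simp [starGraph_two, boundaryCount_top]
      · have := three_le_boundaryCount_starGraph hn
        omega
  · rintro ⟨n, hn, ⟨⟨e⟩⟩ | ⟨⟨e⟩⟩ | ⟨⟨e⟩⟩⟩
    · rw [boundaryField_congr e e₂]
      refine sigmaB_neg_of_four_le (exists_adj_top (by omega)) fun S hS => ?_
      rw [ncard_vertexBoundary_top (Finset.card_pos.1 (by omega))]
      omega
    · rw [boundaryField_congr e e₂]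
      exact sigmaB_neg_of_four_le (exists_adj_cycleGraph (by omega)) fun S hS =>
        four_le_closedNeighborhood_cycleGraph hn hS
    · rw [boundaryField_congr e e₂]
      exact sigmaB_neg_of_four_le (exists_adj_wheelGraph (by omega)) fun S hS =>
        four_le_closedNeighborhood_wheelGraph hn (Finset.card_pos.1 (by omega))
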